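/- Let $\widetilde M$ be a connected noncompact Riemann surface and let $M\subset\widetilde M$ be a compact bordered Riemann surface, sitting in $\widetilde M$ as a smoothly bounded compact (connected) domain. Let $(U_k)_{k\ge 1}$ be a decreasing basis of connected open neighbourhoods of $M$ in $\widetilde M$ such that $U_{k+1}$ is relatively compact in $U_k$ for all $k\ge 1$. Let $X$ be a complex manifold (Hausdorff and second countable). Let $\mathscr O(U_k,X)$ be the space of holomorphic maps $U_k\to X$ with the compact-open topology, let $\mathscr O(M,X)$ be the set of germs along $M$ of holomorphic maps from open neighbourhoods of $M$ in $\widetilde M$ into $X$, let $j_k:\mathscr O(U_k,X)\hookrightarrow\mathscr O(M,X)$ be the (injective) map sending a holomorphic map to its germ, and give $\mathscr O(M,X)$ the colimit topology, that is, the finest topology that makes all the maps $j_k$ continuous. (1) If $L\subset\mathscr O(M,X)$ is sequentially compact, then for all sufficiently large $k$ there is a compact set $C\subset\mathscr O(U_k,X)$ with $j_k(C)=L$; that is, $L$ is a subset of $\mathscr O(U_k,X)$ and is compact there. (2) Let $K$ be a sequentially compact first countable space and let $f:K\to\mathscr O(M,X)$ be a continuous map. Then there are an integer $k\ge 1$ and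 a continuous map $g:K\to\mathscr O(U_k,X)$ such that $f=j_k\circ g$. -/

import Mathlib

open Set Topology TopologicalSpace
open scoped Manifold ContDiff

/-- `M` is a smoothly bounded compact domain in the Riemann surface `S`: it is compact, connected
(in particular nonempty), and near each of its boundary points `p` it is, in the holomorphic
coordinate at `p`, a sublevel set `{ρ ≤ 0}` of a real `C^∞` function `ρ` with `dρ ≠ 0` at `p`. -/
structure IsSmoothlyBoundedCompactDomain {S : Type*} [TopologicalSpace S] [ChartedSpace ℂ S]
    (M : Set S) : Prop where
  isCompact : IsCompact M
  isConnected : IsConnected M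
  smooth_boundary : ∀ p ∈ frontier M, ∃ (V : Set ℂ) (ρ : ℂ → ℝ),
    IsOpen V ∧ chartAt ℂ p p ∈ V ∧ V ⊆ (chartAt ℂ p).target ∧
    ContDiffOn ℝ ∞ ρ V ∧ fderiv ℝ ρ (chartAt ℂ p p) ≠ 0 ∧
    ∀ z ∈ V, (chartAt ℂ p).symm z ∈ M ↔ ρ z ≤ 0

/-- `(U k)` is a decreasing basis of connected open neighbourhoods of `M`, with `U (k + 1)`
relatively compact in `U k` for all `k`. -/
structure IsAdmissibleBasis {S : Type*} [TopologicalSpace S] (M : Set S) (U : ℕ → Opens S) :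
    Prop where
  subset : ∀ k, M ⊆ (U k : Set S)
  isConnected : ∀ k, IsConnected (U k : Set S)
  isCompact_closure : ∀ k, IsCompact (closure (U (k + 1) : Set S))
  closure_subset : ∀ k, closure (U (k + 1) : Set S) ⊆ (U k : Set S)
  basis : ∀ W : Set S, IsOpen W → M ⊆ W → ∃ k, (U k : Set S) ⊆ W

/-- The space of holomorphic maps from an open subset `U` of the Riemann surface `S` into the
complex manifold `X` modelled on `E`, with the compact-open topology (inherited from `C(U, X)`). -/
abbrev HolMap (E : Type*) [NormedAddCommGroup E] [NormedSpace ℂ E]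
    {S : Type*} [TopologicalSpace S] [ChartedSpace ℂ S] (U : Opens S)
    (X : Type*) [TopologicalSpace X] [ChartedSpace E X] : Type _ :=
  {f : C(U, X) // MDifferentiable 𝓘(ℂ, ℂ) 𝓘(ℂ, E) (f : U → X)}

section Germs

variable (E : Type*) [NormedAddCommGroup E] [NormedSpace ℂ E]
  {S : Type*} [TopologicalSpace S] [ChartedSpace ℂ S] (M : Set S)
  (X : Type*) [TopologicalSpace X] [ChartedSpace E X]

/-- Two holomorphic maps, each defined on an open neighbourhood of `M`, have the same germ along
`M` if they agree on a common open neighbourhood of `M`. -/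
instance holGermSetoid : Setoid (Σ U : {U : Opens S // M ⊆ (U : Set S)}, HolMap E U.1 X) where
  r a b := ∃ W : Opens S, M ⊆ (W : Set S) ∧ ∃ (ha : W ≤ a.1.1) (hb : W ≤ b.1.1),
    ∀ x : W, a.2.1 ⟨x, ha x.2⟩ = b.2.1 ⟨x, hb x.2⟩
  iseqv :=
    { refl := fun a => ⟨a.1.1, a.1.2, le_rfl, le_rfl, fun _ => rfl⟩
      symm := by
        rintro a b ⟨W, hW, ha, hb, h⟩
        exact ⟨W, hW, hb, ha, fun x => (h x).symm⟩
      trans := by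
        rintro a b c ⟨W, hW, ha, hb, h⟩ ⟨W', hW', hb', hc, h'⟩
        exact ⟨W ⊓ W', fun x hx => ⟨hW hx, hW' hx⟩, inf_le_left.trans ha, inf_le_right.trans hc,
          fun x => (h ⟨x, x.2.1⟩).trans (h' ⟨x, x.2.2⟩)⟩ }

/-- The set of germs along `M` of holomorphic maps from open neighbourhoods of `M` into `X`. -/
def HolGerm : Type _ := Quotient (holGermSetoid E M X)

variable {E M X} in
/-- The map `HolMap E U X → HolGerm E M X` sending a holomorphic map on an open neighbourhood `U`
of `M` to its germ along `M`. -/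
def HolMap.toGerm {U : Opens S} (hU : M ⊆ (U : Set S)) (f : HolMap E U X) : HolGerm E M X :=
  Quotient.mk (holGermSetoid E M X) ⟨⟨U, hU⟩, f⟩

/-- The colimit topology on the set of germs: the finest topology for which all the maps
`HolMap E (U k) X → HolGerm E M X` are continuous. -/
@[reducible] def colimitTopology (U : ℕ → Opens S) (hU : ∀ k, M ⊆ (U k : Set S)) :
    TopologicalSpace (HolGerm E M X) :=
  ⨆ k, TopologicalSpace.coinduced (HolMap.toGerm (hU k)) inferInstance

end Germs

/-! The inductive system is compact: by Montel's theorem, restriction from `U k` to the relatively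
compact `U (k + 1)` sends some neighbourhood of each map into a compact set. The spaces of maps are
second countable (from `U 1` on), so countably many such compact sets cover the germs, and they
determine the colimit topology. A sequence leaving every finite union of them would have, apart from
its limit, closed range along a convergent subsequence, which is absurd. So a sequentially compact
set lies in a finite union, hence in the image of one compact `B` at a single level.

By the identity theorem a germ is determined by its values on `M`; so the colimit is Hausdorff and
each `j_k` is injective. On `B` the map `j_k` is then a closed embedding, which transfers sequential
compactness back to `HolMap E (U k) X`. For (2), this is applied to the range of `f`, and the same
embedding makes the lift of `f` continuous. -/

/-! ### Sequentially compact sets in countable colimits -/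

open Filter in
/-- If the topology of a T1 space `G` is determined by a countable cover `Q`, then every
sequentially compact subset of `G` is covered by finitely many members of `Q`. -/
theorem IsSeqCompact.exists_finset_subset_biUnion {G ι : Type*} [TopologicalSpace G] [T1Space G]
    [Countable ι] (Q : ι → Set G) (hQ : ∀ A : Set G, (∀ i, IsClosed (A ∩ Q i)) → IsClosed A)
    (hcov : ∀ a, ∃ i, a ∈ Q i) {L : Set G} (hL : IsSeqCompact L) :
    ∃ t : Finset ι, L ⊆ ⋃ i ∈ t, Q i := by
  obtain ⟨e, he⟩ := exists_injective_nat ι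
  by_contra! hcon
  have hx : ∀ n : ℕ, ∃ x ∈ L, ∀ i, e i < n → x ∉ Q i := by
    intro n
    have hfin : {i | e i < n}.Finite := (finite_Iio n).preimage he.injOn
    obtain ⟨x, hxL, hxn⟩ := not_subset.1 (hcon hfin.toFinset)
    refine ⟨x, hxL, fun i hi hxi => hxn ?_⟩
    simp only [mem_iUnion]
    exact ⟨i, by simpa using hi, hxi⟩
  choose x hxL hxQ using hx
  obtain ⟨a, -, φ, hφ, hlim⟩ := hL hxL
  obtain ⟨i₀, hi₀⟩ := hcov a
  have hbound : ∀ i n, x (φ n) ∈ Q i → n ≤ e i := fun i n h => by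
    by_contra! hlt
    exact hxQ (φ n) i (hlt.trans_le (hφ.id_le n)) h
  -- By `hbound` the subsequence meets each `Q i` in only finitely many points, so its range, even
  -- without `a`, is closed.
  have hclosed : IsClosed (Set.range (x ∘ φ) \ {a}) := by
    refine hQ _ fun i => Finite.isClosed ?_
    refine ((finite_Iic (e i)).image (x ∘ φ)).subset ?_
    rintro _ ⟨⟨⟨n, rfl⟩, -⟩, hn⟩
    exact ⟨n, hbound i n hn, rfl⟩
  have hev := hlim.eventually (hclosed.isOpen_compl.mem_nhds (x := a) (by simp))
  obtain ⟨n, hn, hn'⟩ := (hev.and (eventually_gt_atTop (e i₀))).exists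
  have hxa : x (φ n) = a := by
    by_contra hne
    exact hn ⟨⟨n, rfl⟩, hne⟩
  exact absurd (hbound i₀ n (hxa ▸ hi₀)) (not_le.2 hn')

open Filter in
/-- Let `G` be the colimit of second countable metrizable spaces `Y k` along injective maps which
locally send into compact sets. If `G` is Hausdorff, then every sequentially compact subset of `G`
comes from a compact subset of `Y k`, for all large `k`. -/
theorem IsSeqCompact.exists_isCompact_image_eq_of_colimit {Y : ℕ → Type*}
    [∀ k, TopologicalSpace (Y k)] [∀ k, SecondCountableTopology (Y k)] [∀ k, T3Space (Y k)]
    {G : Type*} [TopologicalSpace G] [T2Space G] (j : ∀ k, Y k → G)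
    (hj : ∀ k, Continuous (j k)) (hinj : ∀ k, Function.Injective (j k))
    (hcl : ∀ A : Set G, (∀ k, IsClosed (j k ⁻¹' A)) → IsClosed A)
    (hsurj : ∀ a, ∃ k y, j k y = a)
    (hr : ∀ k l, k ≤ l → ∃ ρ : Y k → Y l, Continuous ρ ∧ ∀ y, j l (ρ y) = j k y)
    (hcpt : ∀ k (y : Y k), ∃ W ∈ 𝓝 y, ∃ C : Set (Y (k + 1)), IsCompact C ∧
      j k '' W ⊆ j (k + 1) '' C)
    {L : Set G} (hL : IsSeqCompact L) :
    ∃ k₀, ∀ k ≥ k₀, ∃ C : Set (Y k), IsCompact C ∧ j k '' C = L := by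
  choose W hW C hC hWC using hcpt
  have hs : ∀ k, ∃ s : Set (Y k), s.Countable ∧ ⋃ y ∈ s, interior (W k y) = univ := fun k =>
    TopologicalSpace.countable_cover_nhds fun y => interior_mem_nhds.2 (hW k y)
  choose s hsc hscov using hs
  have : ∀ k, Countable (s k) := fun k => (hsc k).to_subtype
  let Q : (Σ k, s k) → Set G := fun i => j (i.1 + 1) '' C i.1 i.2
  have hQc : ∀ i, IsCompact (Q i) := fun i => (hC i.1 i.2).image (hj _)
  have hmem : ∀ k (z : Y k), ∃ y : s k, z ∈ interior (W k y) := fun k z => by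
    have hz : z ∈ ⋃ y ∈ s k, interior (W k y) := hscov k ▸ mem_univ z
    simp only [mem_iUnion] at hz
    obtain ⟨y, hy, hzy⟩ := hz
    exact ⟨⟨y, hy⟩, hzy⟩
  -- The pieces `Q` determine the topology: near `z`, on `W k y`, the preimage of `A` agrees with
  -- that of `A ∩ Q ⟨k, y⟩`, which is closed.
  obtain ⟨t, ht⟩ := hL.exists_finset_subset_biUnion Q (fun A hA => hcl A fun k => by
    refine isClosed_of_closure_subset fun z hz => ?_
    obtain ⟨y, hy⟩ := hmem k z
    have hz' : z ∈ closure (interior (W k y) ∩ j k ⁻¹' A) :=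
      isOpen_interior.inter_closure ⟨hy, hz⟩
    have hcl' : IsClosed (j k ⁻¹' (A ∩ Q ⟨k, y⟩)) := (hA ⟨k, y⟩).preimage (hj k)
    refine (closure_minimal ?_ hcl' hz').1
    exact fun w hw => ⟨hw.2, hWC k y ⟨w, interior_subset hw.1, rfl⟩⟩) (fun a => by
      obtain ⟨k, z, rfl⟩ := hsurj a
      obtain ⟨y, hy⟩ := hmem k z
      exact ⟨⟨k, y⟩, hWC k y ⟨z, interior_subset hy, rfl⟩⟩)
  -- The compact set with index `i` lives at level `i.1 + 1`; from the maximum of these levels on,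
  -- all can be pushed to level `k`.
  refine ⟨t.sup fun i => i.1 + 1, fun k hk => ?_⟩
  have hcov : ∀ i ∈ t, ∃ D : Set (Y k), IsCompact D ∧ j k '' D = Q i := fun i hi => by
    obtain ⟨ρ, hρ, hjρ⟩ := hr (i.1 + 1) k
      ((Finset.le_sup (f := fun i : (Σ k, s k) => i.1 + 1) hi).trans hk)
    exact ⟨ρ '' C i.1 i.2, (hC _ _).image hρ, by simp only [image_image, hjρ, Q]⟩
  choose! D hD hDQ using hcov
  let B : Set (Y k) := ⋃ i ∈ t, D i
  have hB : IsCompact B := t.isCompact_biUnion hD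
  have hLB : L ⊆ j k '' B := fun a ha => by
    have := ht ha
    simp only [mem_iUnion] at this
    obtain ⟨i, hi, hai⟩ := this
    rw [← hDQ i hi] at hai
    exact image_mono (subset_biUnion_of_mem (u := D) hi) hai
  have : CompactSpace B := isCompact_iff_compactSpace.1 hB
  have hemb : IsClosedEmbedding (fun b : B => j k b) :=
    ((hj k).comp continuous_subtype_val).isClosedEmbedding
      ((hinj k).comp Subtype.val_injective)
  refine ⟨B ∩ j k ⁻¹' L, ?_, by rw [image_inter_preimage]; exact inter_eq_right.2 hLB⟩
  let _ := TopologicalSpace.metrizableSpaceMetric (Y k)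
  refine IsSeqCompact.isCompact fun u hu => ?_
  obtain ⟨a, ha, φ, hφ, hlim⟩ := hL (fun n => (hu n).2)
  obtain ⟨b, hb, rfl⟩ := hLB ha
  refine ⟨b, ⟨hb, ha⟩, φ, hφ, ?_⟩
  have := hemb.isInducing.tendsto_nhds_iff (f := fun n => (⟨u (φ n), (hu _).1⟩ : B))
    (y := ⟨b, hb⟩) (l := atTop) |>.2 hlim
  exact (continuous_subtype_val.tendsto _).comp this

/-! ### Holomorphic maps in charts and the identity theorem -/

theorem isOpen_chart_preimage {R X : Type*} [TopologicalSpace R] [ChartedSpace ℂ R]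
    [TopologicalSpace X] {f : R → X} (hf : Continuous f) (p : R) {V : Set X} (hV : IsOpen V) :
    IsOpen ((chartAt ℂ p).target ∩ (chartAt ℂ p).symm ⁻¹' (f ⁻¹' V)) :=
  (chartAt ℂ p).isOpen_inter_preimage_symm (hV.preimage hf)

section Charts

variable {E : Type*} [NormedAddCommGroup E] [NormedSpace ℂ E]
  {R : Type*} [TopologicalSpace R] [ChartedSpace ℂ R] [IsManifold 𝓘(ℂ, ℂ) 1 R]
  {X : Type*} [TopologicalSpace X] [ChartedSpace E X] [IsManifold 𝓘(ℂ, E) 1 X]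

theorem mdifferentiable_iff_charts {f : R → X} :
    MDifferentiable 𝓘(ℂ, ℂ) 𝓘(ℂ, E) f ↔ Continuous f ∧ ∀ (p : R) (q : X),
      DifferentiableOn ℂ (chartAt E q ∘ f ∘ (chartAt ℂ p).symm)
        ((chartAt ℂ p).target ∩ (chartAt ℂ p).symm ⁻¹' (f ⁻¹' (chartAt E q).source)) := by
  simp [mdifferentiable_iff, mfld_simps]

theorem MDifferentiable.analyticAt_charts [CompleteSpace E] {f : R → X}
    (hf : MDifferentiable 𝓘(ℂ, ℂ) 𝓘(ℂ, E) f) {p : R} {q : X} (hq : f p ∈ (chartAt E q).source) :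
    AnalyticAt ℂ (chartAt E q ∘ f ∘ (chartAt ℂ p).symm) (chartAt ℂ p p) := by
  refine ((mdifferentiable_iff_charts.1 hf).2 p q).analyticAt
    ((isOpen_chart_preimage hf.continuous p (chartAt E q).open_source).mem_nhds
      ⟨mem_chart_target ℂ p, ?_⟩)
  simpa using hq

open Filter in
/-- Local identity theorem for holomorphic maps from a Riemann surface to a complex manifold. -/
theorem MDifferentiable.eventuallyEq_of_frequently_eq [CompleteSpace E] [T2Space X] {f g : R → X}
    (hf : MDifferentiable 𝓘(ℂ, ℂ) 𝓘(ℂ, E) f) (hg : MDifferentiable 𝓘(ℂ, ℂ) 𝓘(ℂ, E) g) {p : R}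
    (h : ∃ᶠ y in 𝓝[≠] p, f y = g y) : ∀ᶠ y in 𝓝 p, f y = g y := by
  have hp : f p = g p := (isClosed_eq hf.continuous hg.continuous).mem_of_frequently_of_tendsto h
    (tendsto_id.mono_left nhdsWithin_le_nhds)
  set φ := chartAt ℂ p
  set ψ := chartAt E (f p)
  have hsrc : ∀ᶠ y in 𝓝 p, y ∈ φ.source := chart_source_mem_nhds ℂ p
  have hfp : f p ∈ ψ.source := mem_chart_source E (f p)
  have hfs : ∀ᶠ y in 𝓝 p, f y ∈ ψ.source :=
    hf.continuous.continuousAt.eventually_mem (ψ.open_source.mem_nhds hfp)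
  have hgs : ∀ᶠ y in 𝓝 p, g y ∈ ψ.source :=
    hg.continuous.continuousAt.eventually_mem (ψ.open_source.mem_nhds (hp ▸ hfp))
  have hφ : ContinuousAt φ p := φ.continuousAt (mem_chart_source ℂ p)
  have htend : Tendsto φ (𝓝[≠] p) (𝓝[≠] (φ p)) := by
    refine tendsto_nhdsWithin_of_tendsto_nhds_of_eventually_within _
      (hφ.mono_left nhdsWithin_le_nhds) ?_
    filter_upwards [hsrc.filter_mono nhdsWithin_le_nhds, self_mem_nhdsWithin] with y hy hne heq
    exact hne (φ.injOn hy (mem_chart_source ℂ p) heq)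
  have hfreq : ∃ᶠ z in 𝓝[≠] (φ p), (ψ ∘ f ∘ φ.symm) z = (ψ ∘ g ∘ φ.symm) z := by
    refine htend.frequently ((h.and_eventually (hsrc.filter_mono nhdsWithin_le_nhds)).mono ?_)
    rintro y ⟨hy, hys⟩
    simp [φ.left_inv hys, hy]
  have hev := ((hf.analyticAt_charts hfp).frequently_eq_iff_eventually_eq
    (hg.analyticAt_charts (hp ▸ hfp))).1 hfreq
  filter_upwards [hφ.eventually hev, hsrc, hfs, hgs] with y hy hys hyf hyg
  refine ψ.injOn hyf hyg ?_
  change ψ (f (φ.symm (φ y))) = ψ (g (φ.symm (φ y))) at hy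
  rwa [φ.left_inv hys] at hy

open Filter in
/-- Identity theorem for holomorphic maps from a connected Riemann surface to a complex
manifold. -/
theorem MDifferentiable.eq_of_frequently_eq [CompleteSpace E] [T2Space X] [T1Space R]
    [PreconnectedSpace R] {f g : R → X}
    (hf : MDifferentiable 𝓘(ℂ, ℂ) 𝓘(ℂ, E) f) (hg : MDifferentiable 𝓘(ℂ, ℂ) 𝓘(ℂ, E) g) {p : R}
    (h : ∃ᶠ y in 𝓝[≠] p, f y = g y) : f = g := by
  obtain ⟨y, -, hy⟩ := (h.and_eventually self_mem_nhdsWithin).exists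
  have : Nontrivial R := ⟨y, p, hy⟩
  have : ConnectedSpace R := { toNonempty := ⟨p⟩ }
  let A : Set R := {x | ∀ᶠ y in 𝓝 x, f y = g y}
  have hA : IsOpen A := isOpen_setOfPred_eventually_nhds
  -- Points of the closure outside `A` are accumulation points of `A`, so the local identity theorem
  -- shows that `A` is closed.
  have hfreq : ∀ x ∈ closure A, ∃ᶠ y in 𝓝[≠] x, f y = g y := by
    intro x hx
    by_cases hxA : x ∈ A
    · exact (Filter.Eventually.filter_mono nhdsWithin_le_nhds hxA).frequently
    · refine frequently_nhdsWithin_iff.2 ((mem_closure_iff_frequently.1 hx).mono fun y hy => ?_)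
      exact ⟨Filter.Eventually.self_of_nhds (p := fun y => f y = g y) hy, fun hyx => hxA (hyx ▸ hy)⟩
  have hclopen : IsClopen A :=
    ⟨isClosed_of_closure_subset fun x hx => hf.eventuallyEq_of_frequently_eq hg (hfreq x hx), hA⟩
  have huniv := hclopen.eq_univ ⟨p, hf.eventuallyEq_of_frequently_eq hg h⟩
  ext x
  have hx : x ∈ A := huniv ▸ mem_univ x
  exact Filter.Eventually.self_of_nhds (p := fun y => f y = g y) hx

end Charts

/-! ### Weierstrass and Montel theorems for manifold targets -/

section Limits

variable {E : Type*} [NormedAddCommGroup E] [NormedSpace ℂ E]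
  {R : Type*} [TopologicalSpace R] [ChartedSpace ℂ R] [IsManifold 𝓘(ℂ, ℂ) 1 R]
  {X : Type*} [UniformSpace X] [ChartedSpace E X] [IsManifold 𝓘(ℂ, E) 1 X]

open Filter in
/-- Limits of holomorphic maps in the compact-open topology are holomorphic. -/
theorem isClosed_setOf_mdifferentiable [CompleteSpace E] :
    IsClosed {f : C(R, X) | MDifferentiable 𝓘(ℂ, ℂ) 𝓘(ℂ, E) f} := by
  refine isClosed_of_closure_subset fun f hf => ?_
  refine mdifferentiable_iff_charts.2 ⟨f.continuous, fun p q z₀ hz₀ => ?_⟩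
  have hopen := isOpen_chart_preimage f.continuous p (chartAt E q).open_source
  refine DifferentiableAt.differentiableWithinAt ?_
  obtain ⟨r, hr, hball⟩ := Metric.nhds_basis_closedBall.mem_iff.1 (hopen.mem_nhds hz₀)
  set φ := chartAt ℂ p
  set ψ := chartAt E q
  set K : Set R := φ.symm '' Metric.closedBall z₀ r with hKdef
  have hK : IsCompact K := (isCompact_closedBall z₀ r).image_of_continuousOn
    (φ.continuousOn_symm.mono fun z hz => (hball hz).1)
  have hfK : MapsTo f K ψ.source := by
    rintro _ ⟨z, hz, rfl⟩
    exact (hball hz).2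
  have : (𝓝 f ⊓ 𝓟 {g : C(R, X) | MDifferentiable 𝓘(ℂ, ℂ) 𝓘(ℂ, E) g}).NeBot :=
    mem_closure_iff_clusterPt.1 hf
  set l := 𝓝 f ⊓ 𝓟 {g : C(R, X) | MDifferentiable 𝓘(ℂ, ℂ) 𝓘(ℂ, E) g}
  have hlim : Tendsto (fun g : C(R, X) => g) l (𝓝 f) := inf_le_left
  have hunif := ContinuousMap.tendsto_iff_forall_isCompact_tendstoUniformlyOn.1 hlim K hK
  have hev : ∀ᶠ g : C(R, X) in l, MapsTo g K ψ.source :=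
    hlim.eventually (ContinuousMap.eventually_mapsTo hK ψ.open_source hfK)
  have hev' : ∀ᶠ g : C(R, X) in l, MDifferentiable 𝓘(ℂ, ℂ) 𝓘(ℂ, E) g :=
    Filter.Eventually.filter_mono inf_le_right (mem_principal_self _)
  have hdiff : DifferentiableOn ℂ (ψ ∘ f ∘ φ.symm) (Metric.ball z₀ r) := by
    refine TendstoLocallyUniformlyOn.differentiableOn
      (F := fun (g : C(R, X)) => ψ ∘ g ∘ φ.symm) (φ := l) ?_ ?_ Metric.isOpen_ball
    · refine TendstoUniformlyOn.tendstoLocallyUniformlyOn fun u hu => ?_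
      have hψ := (hK.image f.continuous).uniformContinuousAt_of_continuousAt ψ
        (by
          rintro _ ⟨y, hy, rfl⟩
          exact ψ.continuousAt (hfK hy)) hu
      filter_upwards [hunif _ hψ] with g hg z hz
      have hzK : φ.symm z ∈ K := mem_image_of_mem _ (Metric.ball_subset_closedBall hz)
      exact hg _ hzK (mem_image_of_mem _ hzK)
    · filter_upwards [hev, hev'] with g hg hgd
      refine ((mdifferentiable_iff_charts.1 hgd).2 p q).mono fun z hz => ?_
      have hz' := Metric.ball_subset_closedBall hz
      exact ⟨(hball hz').1, hg (mem_image_of_mem _ hz')⟩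
  exact hdiff.differentiableAt (Metric.ball_mem_nhds _ hr)

open Filter in
/-- Holomorphic maps that send a suitable compact neighbourhood of a point into a small open set
are equicontinuous and uniformly bounded near this point. -/
theorem MDifferentiable.exists_locally_equicontinuous [FiniteDimensional ℂ E] {f : R → X}
    (hf : Continuous f) (x : R) :
    ∃ (K : Set R) (V : Set X), IsCompact K ∧ IsOpen V ∧ MapsTo f K V ∧
      ∃ O ∈ 𝓝 x, ∃ Q : Set X, IsCompact Q ∧ ∀ y ∈ O,
        (∀ g : R → X, MDifferentiable 𝓘(ℂ, ℂ) 𝓘(ℂ, E) g → MapsTo g K V → g y ∈ Q) ∧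
        ∀ u ∈ uniformity X, ∀ᶠ y' in 𝓝 y, ∀ g : R → X, MDifferentiable 𝓘(ℂ, ℂ) 𝓘(ℂ, E) g →
          MapsTo g K V → (g y, g y') ∈ u := by
  have : ProperSpace E := FiniteDimensional.proper ℂ E
  set φ := chartAt ℂ x
  set ψ := chartAt E (f x)
  set c := φ x
  set e := ψ (f x)
  have hfx : f x ∈ ψ.source := mem_chart_source E (f x)
  obtain ⟨ρ, hρ, hρt⟩ := Metric.nhds_basis_closedBall.mem_iff.1
    (ψ.open_target.mem_nhds (ψ.map_source hfx))
  set V : Set X := ψ.source ∩ ψ ⁻¹' Metric.ball e ρ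
  have hV : IsOpen V := ψ.isOpen_inter_preimage Metric.isOpen_ball
  have hxV : f x ∈ V := ⟨hfx, Metric.mem_ball_self hρ⟩
  have hc : c ∈ φ.target ∩ φ.symm ⁻¹' (f ⁻¹' V) := by
    refine ⟨mem_chart_target ℂ x, ?_⟩
    simpa [c, φ] using hxV
  obtain ⟨r', hr', hball⟩ := Metric.nhds_basis_closedBall.mem_iff.1
    ((isOpen_chart_preimage hf x hV).mem_nhds hc)
  -- Radius `2 * r` leaves room for a disc of radius `r` around every point of `Metric.ball c r`.
  obtain ⟨r, rfl⟩ : ∃ r, r' = 2 * r := ⟨r' / 2, by ring⟩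
  have hr : 0 < r := by linarith
  set K : Set R := φ.symm '' Metric.closedBall c (2 * r)
  have hK : IsCompact K := (isCompact_closedBall c (2 * r)).image_of_continuousOn
    (φ.continuousOn_symm.mono fun z hz => (hball hz).1)
  have hball' : ∀ y, φ y ∈ Metric.ball c r → Metric.ball (φ y) r ⊆ Metric.closedBall c (2 * r) :=
    fun y hy => (Metric.ball_subset_closedBall).trans <| Metric.closedBall_subset_closedBall' <| by
      have := Metric.mem_ball.1 hy
      linarith
  -- the local representative of `g` and its properties
  have hG : ∀ g : R → X, MapsTo g K V →
      MapsTo (ψ ∘ g ∘ φ.symm) (Metric.closedBall c (2 * r)) (Metric.ball e ρ) :=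
    fun g hg z hz => (hg (mem_image_of_mem _ hz)).2
  have hgG : ∀ g : R → X, MapsTo g K V → ∀ y ∈ φ.source, φ y ∈ Metric.closedBall c (2 * r) →
      g y = ψ.symm ((ψ ∘ g ∘ φ.symm) (φ y)) := fun g hg y hy hyc => by
    have h := (hg (mem_image_of_mem _ hyc)).1
    rw [φ.left_inv hy] at h
    simp [φ.left_inv hy, ψ.left_inv h]
  refine ⟨K, V, hK, hV, ?_, φ.source ∩ φ ⁻¹' Metric.ball c r,
    (φ.isOpen_inter_preimage Metric.isOpen_ball).mem_nhds
      ⟨mem_chart_source ℂ x, Metric.mem_ball_self hr⟩,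
    ψ.symm '' Metric.closedBall e ρ, (isCompact_closedBall e ρ).image_of_continuousOn
      (ψ.continuousOn_symm.mono hρt), ?_⟩
  · rintro _ ⟨z, hz, rfl⟩
    exact (hball hz).2
  rintro y ⟨hy, hyc⟩
  have hyc' := hball' y hyc (Metric.mem_ball_self hr)
  refine ⟨fun g _ hg => ?_, fun u hu => ?_⟩
  · rw [hgG g hg y hy hyc']
    exact mem_image_of_mem _ (Metric.ball_subset_closedBall (hG g hg hyc'))
  have hψ := (isCompact_closedBall e ρ).uniformContinuousAt_of_continuousAt ψ.symm
    (fun a ha => ψ.symm.continuousAt (hρt ha)) hu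
  obtain ⟨δ, hδ, hδu⟩ := Metric.mem_uniformity_dist.1 hψ
  have hφ : Tendsto φ (𝓝 y) (𝓝 (φ y)) := φ.continuousAt hy
  -- The Schwarz lemma on a disc of radius `r`, with values within `2 * ρ` of the central value,
  -- gives the Lipschitz constant `2 * ρ / r`, independent of `g`.
  have hsmall : Tendsto (fun y' => 2 * ρ / r * dist (φ y') (φ y)) (𝓝 y) (𝓝 0) := by
    simpa using (tendsto_iff_dist_tendsto_zero.1 hφ).const_mul (2 * ρ / r)
  filter_upwards [φ.open_source.mem_nhds hy, hφ (Metric.ball_mem_nhds (φ y) hr),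
    hsmall.eventually_lt_const hδ] with y' hy's hy'r hy'δ g hgd hg
  rw [hgG g hg y hy hyc', hgG g hg y' hy's (hball' y hyc hy'r)]
  refine hδu ?_ (Metric.ball_subset_closedBall (hG g hg hyc'))
  rw [dist_comm]
  refine lt_of_le_of_lt (Complex.dist_le_div_mul_dist_of_mapsTo_ball
    (f := ψ ∘ g ∘ φ.symm) ?_ ?_ hy'r) hy'δ
  · refine ((mdifferentiable_iff_charts.1 hgd).2 x (f x)).mono fun z hz => ?_
    have hz' := hball' y hyc hz
    exact ⟨(hball hz').1, (hg (mem_image_of_mem _ hz')).1⟩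
  · intro z hz
    have h₁ := Metric.mem_ball.1 (hG g hg (hball' y hyc hz))
    have h₂ := Metric.mem_ball'.1 (hG g hg hyc')
    have := dist_triangle ((ψ ∘ g ∘ φ.symm) z) e ((ψ ∘ g ∘ φ.symm) (φ y))
    rw [Metric.mem_closedBall]
    linarith

open Filter in
/-- Montel's theorem for maps into a complex manifold: restricting holomorphic maps to a relatively
compact subset sends a neighbourhood of each holomorphic map to a relatively compact set. -/
theorem MDifferentiable.exists_isCompact_closure_restrict [FiniteDimensional ℂ E] [T2Space X]
    {R' : Type*} [TopologicalSpace R'] [WeaklyLocallyCompactSpace R'] (i : C(R', R)) {A : Set R}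
    (hA : IsCompact A) (hiA : ∀ x, i x ∈ A) (f : C(R, X)) :
    ∃ W ∈ 𝓝 f, IsCompact (closure ((fun g : C(R, X) => g.comp i) ''
      (W ∩ {g | MDifferentiable 𝓘(ℂ, ℂ) 𝓘(ℂ, E) g}))) := by
  choose K V hK hV hKV O hO Q hQ hOQ using
    MDifferentiable.exists_locally_equicontinuous (E := E) f.continuous
  obtain ⟨t, -, ht⟩ := hA.elim_nhds_subcover O fun x _ => hO x
  have hcov : ∀ y, ∃ x ∈ t, i y ∈ O x := fun y => by simpa using ht (hiA y)
  have hW : ∀ᶠ g : C(R, X) in 𝓝 f, ∀ x ∈ t, MapsTo g (K x) (V x) :=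
    (Filter.eventually_all_finset t).2 fun x _ =>
      ContinuousMap.eventually_mapsTo (hK x) (hV x) (hKV x)
  refine ⟨_, hW, ?_⟩
  have hclemb : IsClosedEmbedding (ContinuousMap.toUniformOnFunIsCompact : C(R', X) → _) :=
    ⟨ContinuousMap.isUniformEmbedding_toUniformOnFunIsCompact.isEmbedding, by
      rw [ContinuousMap.range_toUniformOnFunIsCompact]
      exact UniformOnFun.isClosed_setOfPred_continuous CompactlyCoherentSpace.isCoherentWith⟩
  refine ArzelaAscoli.isCompact_closure_of_isClosedEmbedding (F := fun g : C(R', X) => ⇑g)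
    (𝔖 := {K | IsCompact K}) (fun _ h => h) hclemb (fun _ _ y _ => ?_) (fun _ _ y _ => ?_)
  · refine EquicontinuousAt.equicontinuousWithinAt (fun u hu => ?_) _
    obtain ⟨x, hx, hy⟩ := hcov y
    filter_upwards [i.continuous.continuousAt.eventually ((hOQ x _ hy).2 u hu)] with y' hy'
    rintro ⟨_, g, ⟨hg, hgd⟩, rfl⟩
    exact hy' g hgd (hg x hx)
  · obtain ⟨x, hx, hy⟩ := hcov y
    refine ⟨Q x, hQ x, ?_⟩
    rintro _ ⟨g, ⟨hg, hgd⟩, rfl⟩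
    exact (hOQ x _ hy).1 g hgd (hg x hx)

end Limits

/-! ### Topology of `M` and its neighbourhoods -/

/-- If `M` were a point, its defining function would have a local minimum there, against `dρ ≠ 0`.
Being connected with two points, `M` has no isolated point, as the identity theorem requires. -/
theorem IsSmoothlyBoundedCompactDomain.nontrivial {S : Type*} [TopologicalSpace S] [T1Space S]
    [PreconnectedSpace S] [NoncompactSpace S] [ChartedSpace ℂ S] {M : Set S}
    (hM : IsSmoothlyBoundedCompactDomain M) : M.Nontrivial := by
  by_contra hnt
  obtain ⟨p, hp⟩ := hM.isConnected.nonempty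
  obtain rfl : M = {p} := (not_nontrivial_iff.1 hnt).eq_singleton_of_mem hp
  have hfr : p ∈ frontier {p} := by
    refine ⟨subset_closure rfl, fun hint => ?_⟩
    have hclopen : IsClopen ({p} : Set S) :=
      ⟨isClosed_singleton, interior_eq_iff_isOpen.1 (interior_subset.antisymm (singleton_subset_iff.2 hint))⟩
    exact noncompact_univ S (hclopen.eq_univ ⟨p, rfl⟩ ▸ isCompact_singleton)
  obtain ⟨V, ρ, hV, hpV, hVt, -, hρ, hMρ⟩ := hM.smooth_boundary p hfr
  refine hρ (IsLocalMin.fderiv_eq_zero ?_)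
  have hp0 : ρ (chartAt ℂ p p) ≤ 0 := (hMρ _ hpV).1 (by simp)
  filter_upwards [hV.mem_nhds hpV] with z hz
  by_contra! hlt
  have hzp : (chartAt ℂ p).symm z = p := (hMρ z hz).2 (hlt.le.trans hp0)
  have : z = chartAt ℂ p p := by rw [← (chartAt ℂ p).right_inv (hVt hz), hzp]
  exact absurd hlt (this ▸ lt_irrefl _)

/-- An open set with compact closure in a manifold is second countable. -/
theorem secondCountableTopology_of_isCompact_closure (H : Type*) [TopologicalSpace H]
    [SecondCountableTopology H] {S : Type*} [TopologicalSpace S] [ChartedSpace H S] {V : Opens S}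
    (hV : IsCompact (closure (V : Set S))) : SecondCountableTopology V := by
  obtain ⟨t, -, ht⟩ := hV.elim_nhds_subcover (fun x => (chartAt H x).source)
    fun x _ => chart_source_mem_nhds H x
  have (x : t) : SecondCountableTopology
      ((Subtype.val : V → S) ⁻¹' (chartAt H (x : S)).source) := by
    have := (chartAt H (x : S)).secondCountableTopology_source
    have hind : IsInducing (fun y : (Subtype.val : V → S) ⁻¹' (chartAt H (x : S)).source =>
        (⟨y.1.1, y.2⟩ : (chartAt H (x : S)).source)) := by
      rw [← IsInducing.subtypeVal.of_comp_iff]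
      exact (IsInducing.subtypeVal (t := (V : Set S))).comp IsInducing.subtypeVal
    exact hind.secondCountableTopology
  refine secondCountableTopology_of_countable_cover
    (U := fun x : t => (Subtype.val : V → S) ⁻¹' (chartAt H (x : S)).source)
    (fun x => (chartAt H (x : S)).open_source.preimage continuous_subtype_val) ?_
  refine eq_univ_of_forall fun y => ?_
  have hy := ht (subset_closure y.2)
  simp only [mem_iUnion] at hy ⊢
  obtain ⟨x, hx, hyx⟩ := hy
  exact ⟨⟨x, hx⟩, hyx⟩

/-! ### Restriction, germs and evaluation -/

section Holomorphic

variable {E : Type*} [NormedAddCommGroup E] [NormedSpace ℂ E]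
  {S : Type*} [TopologicalSpace S] [ChartedSpace ℂ S]
  {X : Type*} [TopologicalSpace X] [ChartedSpace E X]

/-- Restriction of holomorphic maps to a smaller open set. -/
def HolMap.restrict {U V : Opens S} (h : V ≤ U) (f : HolMap E U X) : HolMap E V X :=
  ⟨f.1.comp ⟨inclusion h, continuous_inclusion h⟩,
    f.2.comp ((contMDiff_inclusion (n := 1) h).mdifferentiable one_ne_zero)⟩

theorem HolMap.continuous_restrict {U V : Opens S} (h : V ≤ U) :
    Continuous (HolMap.restrict h : HolMap E U X → HolMap E V X) :=
  ((ContinuousMap.continuous_precomp _).comp continuous_subtype_val).subtype_mk _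

theorem HolMap.toGerm_restrict {M : Set S} {U V : Opens S} (h : V ≤ U) (hV : M ⊆ (V : Set S))
    (f : HolMap E U X) :
    HolMap.toGerm hV (f.restrict h) = HolMap.toGerm (hV.trans h) f :=
  Quotient.sound ⟨V, hV, le_rfl, h, fun _ => rfl⟩

/-- The values of a germ at the points of `M`. -/
def HolGerm.eval {M : Set S} (a : HolGerm E M X) (m : M) : X :=
  Quotient.lift (s := holGermSetoid E M X) (fun b => b.2.1 ⟨m, b.1.2 m.2⟩)
    (by
      rintro a b ⟨W, hW, ha, hb, h⟩
      exact h ⟨m, hW m.2⟩) a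

theorem HolGerm.eval_toGerm {M : Set S} {U : Opens S} (hU : M ⊆ (U : Set S)) (f : HolMap E U X)
    (m : M) : (HolMap.toGerm hU f).eval m = f.1 ⟨m, hU m.2⟩ := rfl

theorem HolMap.eq_of_eqOn [T1Space S] [IsManifold 𝓘(ℂ, ℂ) 1 S] [CompleteSpace E] [T2Space X]
    [IsManifold 𝓘(ℂ, E) 1 X] {M : Set S} (hM : IsPreconnected M) (hM' : M.Nontrivial)
    {U : Opens S} (hU : IsPreconnected (U : Set S)) (hMU : M ⊆ (U : Set S)) {f g : HolMap E U X}
    (h : ∀ m : M, f.1 ⟨m, hMU m.2⟩ = g.1 ⟨m, hMU m.2⟩) : f = g := by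
  obtain ⟨p, hp⟩ := hM'.nonempty
  have : PreconnectedSpace U := isPreconnected_iff_preconnectedSpace.1 hU
  refine Subtype.ext (DFunLike.coe_injective
    (f.2.eq_of_frequently_eq g.2 (p := ⟨p, hMU hp⟩) (frequently_nhdsWithin_iff.2 ?_)))
  have hacc := accPt_iff_frequently.1 (hM.preperfect_of_nontrivial hM' p hp)
  rw [← U.isOpen.isOpenEmbedding_subtypeVal.map_nhds_eq ⟨p, hMU hp⟩, Filter.frequently_map] at hacc
  exact hacc.mono fun y ⟨hyp, hyM⟩ => ⟨h ⟨y, hyM⟩, fun hy => hyp (congrArg Subtype.val hy)⟩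

end Holomorphic

/-- Montel's theorem, combined with the closedness of the holomorphic maps in `C(V, X)`. -/
theorem HolMap.exists_isCompact_restrict {S : Type*} [TopologicalSpace S] [ChartedSpace ℂ S]
    [LocallyCompactSpace S] [IsManifold 𝓘(ℂ, ℂ) 1 S]
    {E : Type*} [NormedAddCommGroup E] [NormedSpace ℂ E] [FiniteDimensional ℂ E]
    {X : Type*} [tX : TopologicalSpace X] [ChartedSpace E X] [MetrizableSpace X]
    [IsManifold 𝓘(ℂ, E) 1 X] {U V : Opens S} (hc : IsCompact (closure (V : Set S)))
    (hVU : closure (V : Set S) ⊆ U) (f : HolMap E U X) :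
    ∃ W ∈ 𝓝 f, ∃ C : Set (HolMap E V X), IsCompact C ∧
      HolMap.restrict (subset_closure.trans hVU) '' W ⊆ C := by
  have hT2 : T2Space X := inferInstance
  obtain ⟨u, rfl⟩ : ∃ u : UniformSpace X, u.toTopologicalSpace = tX := by
    let _ := metrizableSpaceMetric X
    exact ⟨inferInstance, rfl⟩
  have : CompleteSpace E := FiniteDimensional.complete ℂ E
  have : LocallyCompactSpace V := V.isOpen.locallyCompactSpace
  let i : C(V, U) := ⟨inclusion (subset_closure.trans hVU), continuous_inclusion _⟩
  have hA : IsCompact ((Subtype.val : U → S) ⁻¹' closure (V : Set S)) := by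
    rwa [Subtype.isCompact_iff, image_preimage_eq_of_subset (by simpa using hVU)]
  obtain ⟨W, hW, hWc⟩ := MDifferentiable.exists_isCompact_closure_restrict (E := E) i hA
    (fun x => subset_closure x.2) f.1
  have hclemb : IsClosedEmbedding (Subtype.val : HolMap E V X → C(V, X)) :=
    (isClosed_setOf_mdifferentiable (E := E)).isClosedEmbedding_subtypeVal
  refine ⟨Subtype.val ⁻¹' W, continuous_subtype_val.continuousAt hW, _,
    hclemb.isCompact_preimage hWc, ?_⟩
  rintro _ ⟨g, hg, rfl⟩
  exact subset_closure ⟨g.1, ⟨hg, g.2⟩, rfl⟩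

theorem HolMap.continuous_toGerm {S : Type*} [TopologicalSpace S] [ChartedSpace ℂ S] {M : Set S}
    {E : Type*} [NormedAddCommGroup E] [NormedSpace ℂ E]
    {X : Type*} [TopologicalSpace X] [ChartedSpace E X]
    {U : ℕ → Opens S} (hU : ∀ k, M ⊆ (U k : Set S)) (k : ℕ) :
    Continuous[inferInstance, colimitTopology E M X U hU] (HolMap.toGerm (E := E) (X := X) (hU k)) :=
  continuous_iff_coinduced_le.2
    (le_iSup (fun k => coinduced (HolMap.toGerm (E := E) (X := X) (hU k)) inferInstance) k)

theorem HolGerm.continuous_eval {S : Type*} [TopologicalSpace S] [ChartedSpace ℂ S] {M : Set S}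
    {E : Type*} [NormedAddCommGroup E] [NormedSpace ℂ E]
    {X : Type*} [TopologicalSpace X] [ChartedSpace E X]
    {U : ℕ → Opens S} (hU : ∀ k, M ⊆ (U k : Set S)) :
    Continuous[colimitTopology E M X U hU, inferInstance]
      (HolGerm.eval : HolGerm E M X → M → X) := by
  refine continuous_iSup_dom.2 fun k => continuous_coinduced_dom.2 ?_
  refine continuous_pi fun m => ?_
  exact (ContinuousEvalConst.continuous_eval_const (F := C(U k, X)) ⟨m, hU k m.2⟩).comp continuous_subtype_val

theorem IsAdmissibleBasis.antitone {S : Type*} [TopologicalSpace S] {M : Set S} {U : ℕ → Opens S}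
    (hU : IsAdmissibleBasis M U) : Antitone U :=
  antitone_nat_of_succ_le fun k => subset_closure.trans (hU.closure_subset k)

/-! ### The colimit topology on germs -/

section Colimit

variable {S : Type*} [TopologicalSpace S] [T2Space S] [ChartedSpace ℂ S]
  [IsManifold 𝓘(ℂ, ℂ) 1 S] {M : Set S} {U : ℕ → Opens S}
  {E : Type*} [NormedAddCommGroup E] [NormedSpace ℂ E] [FiniteDimensional ℂ E]
  {X : Type*} [TopologicalSpace X] [T2Space X] [ChartedSpace E X] [IsManifold 𝓘(ℂ, E) 1 X]

omit [T2Space S] [IsManifold 𝓘(ℂ, ℂ) 1 S] [FiniteDimensional ℂ E] [T2Space X]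
  [IsManifold 𝓘(ℂ, E) 1 X] in
theorem IsAdmissibleBasis.exists_toGerm_eq (hU : IsAdmissibleBasis M U) (a : HolGerm E M X) :
    ∃ k₀, ∀ k ≥ k₀, ∃ f : HolMap E (U k) X, HolMap.toGerm (hU.subset k) f = a := by
  obtain ⟨⟨⟨W, hMW⟩, f⟩, rfl⟩ := Quotient.exists_rep (s := holGermSetoid E M X) a
  obtain ⟨k₀, hk₀⟩ := hU.basis W W.isOpen hMW
  refine ⟨k₀, fun k hk => ⟨f.restrict ((hU.antitone hk).trans hk₀), ?_⟩⟩
  exact HolMap.toGerm_restrict _ (hU.subset k) f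

theorem IsAdmissibleBasis.toGerm_injective (hU : IsAdmissibleBasis M U) (hM : IsPreconnected M)
    (hM' : M.Nontrivial) (k : ℕ) :
    Function.Injective (HolMap.toGerm (E := E) (X := X) (hU.subset k)) := fun f g hfg => by
  have : CompleteSpace E := FiniteDimensional.complete ℂ E
  exact HolMap.eq_of_eqOn hM hM' (hU.isConnected k).isPreconnected (hU.subset k) fun m =>
    congrArg (fun a : HolGerm E M X => a.eval m) hfg

theorem IsAdmissibleBasis.eval_injective (hU : IsAdmissibleBasis M U) (hM : IsPreconnected M)
    (hM' : M.Nontrivial) : Function.Injective (HolGerm.eval : HolGerm E M X → M → X) := by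
  have : CompleteSpace E := FiniteDimensional.complete ℂ E
  intro a b hab
  obtain ⟨k, hk⟩ := hU.exists_toGerm_eq a
  obtain ⟨l, hl⟩ := hU.exists_toGerm_eq b
  obtain ⟨f, rfl⟩ := hk (max k l) (le_max_left _ _)
  obtain ⟨g, rfl⟩ := hl (max k l) (le_max_right _ _)
  exact congrArg _
    (HolMap.eq_of_eqOn hM hM' (hU.isConnected _).isPreconnected (hU.subset _) (congrFun hab))

/-- Evaluation embeds the germs injectively and continuously in the Hausdorff product `M → X`. -/
theorem IsAdmissibleBasis.t2Space_colimitTopology (hU : IsAdmissibleBasis M U)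
    (hM : IsPreconnected M) (hM' : M.Nontrivial) :
    @T2Space _ (colimitTopology E M X U hU.subset) :=
  let _ := colimitTopology E M X U hU.subset
  .of_injective_continuous (hU.eval_injective hM hM') (HolGerm.continuous_eval hU.subset)

theorem IsAdmissibleBasis.exists_isCompact_image_toGerm_eq [SecondCountableTopology X]
    (hU : IsAdmissibleBasis M U) (hM : IsPreconnected M) (hM' : M.Nontrivial)
    {L : Set (HolGerm E M X)} (hL : @IsSeqCompact _ (colimitTopology E M X U hU.subset) L) :
    ∃ k₀ : ℕ, ∀ k ≥ k₀, ∃ C : Set (HolMap E (U k) X),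
      IsCompact C ∧ HolMap.toGerm (hU.subset k) '' C = L := by
  let _ := colimitTopology E M X U hU.subset
  have := hU.t2Space_colimitTopology (E := E) (X := X) hM hM'
  have : ProperSpace E := FiniteDimensional.proper ℂ E
  have : LocallyCompactSpace S := ChartedSpace.locallyCompactSpace ℂ S
  have : LocallyCompactSpace X := ChartedSpace.locallyCompactSpace E X
  have (k : ℕ) : LocallyCompactSpace (U k) := (U k).isOpen.locallyCompactSpace
  -- `U 0` need not have compact closure, so the argument uses the cofinal tail `U (k + 1)`;
  -- restriction shows that the tail induces the same topology.
  have (k : ℕ) : SecondCountableTopology (U (k + 1)) :=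
    secondCountableTopology_of_isCompact_closure ℂ (hU.isCompact_closure k)
  have (k : ℕ) : SecondCountableTopology (HolMap E (U (k + 1)) X) :=
    IsInducing.subtypeVal.secondCountableTopology
  obtain ⟨k₀, hk₀⟩ := hL.exists_isCompact_image_eq_of_colimit
    (Y := fun k => HolMap E (U (k + 1)) X) (fun k => HolMap.toGerm (hU.subset (k + 1)))
    (fun k => HolMap.continuous_toGerm hU.subset (k + 1))
    (fun k => hU.toGerm_injective hM hM' (k + 1))
    (fun A hA => isClosed_iSup_iff.2 fun k => isClosed_coinduced.2 <| by
      have hle : U (k + 1) ≤ U k := hU.antitone k.le_succ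
      convert (hA k).preimage (HolMap.continuous_restrict (E := E) (X := X) hle) using 1
      ext f
      simp only [mem_preimage, HolMap.toGerm_restrict])
    (fun a => by
      obtain ⟨k, hk⟩ := hU.exists_toGerm_eq a
      exact ⟨k, hk (k + 1) k.le_succ⟩)
    (fun k l hkl => ⟨HolMap.restrict (hU.antitone (Nat.succ_le_succ hkl)),
      HolMap.continuous_restrict _, fun f => HolMap.toGerm_restrict _ (hU.subset (l + 1)) f⟩)
    (fun k f => by
      obtain ⟨W, hW, C, hC, hWC⟩ := HolMap.exists_isCompact_restrict
        (hU.isCompact_closure (k + 1)) (hU.closure_subset (k + 1)) f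
      refine ⟨W, hW, C, hC, ?_⟩
      rintro _ ⟨g, hg, rfl⟩
      exact ⟨_, hWC ⟨g, hg, rfl⟩, HolMap.toGerm_restrict _ (hU.subset (k + 1 + 1)) g⟩)
  refine ⟨k₀ + 1, fun k hk => ?_⟩
  obtain ⟨l, rfl⟩ : ∃ l, k = l + 1 := ⟨k - 1, by omega⟩
  exact hk₀ l (by omega)

end Colimit

/-! ### The two assertions -/

theorem propositionp
    {S : Type*} [TopologicalSpace S] [T2Space S] [ConnectedSpace S] [NoncompactSpace S]
    [ChartedSpace ℂ S] [IsManifold 𝓘(ℂ, ℂ) ω S]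
    (M : Set S) (hM : IsSmoothlyBoundedCompactDomain M)
    (U : ℕ → Opens S) (hU : IsAdmissibleBasis M U)
    {E : Type*} [NormedAddCommGroup E] [NormedSpace ℂ E] [FiniteDimensional ℂ E]
    {X : Type*} [TopologicalSpace X] [T2Space X] [SecondCountableTopology X]
    [ChartedSpace E X] [IsManifold 𝓘(ℂ, E) ω X] :
    (∀ L : Set (HolGerm E M X), @IsSeqCompact _ (colimitTopology E M X U hU.subset) L →
      ∃ k₀ : ℕ, ∀ k ≥ k₀, ∃ C : Set (HolMap E (U k) X),
        IsCompact C ∧ HolMap.toGerm (hU.subset k) '' C = L) ∧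
    (∀ (K : Type*) [TopologicalSpace K] [SeqCompactSpace K] [FirstCountableTopology K]
      (f : K → HolGerm E M X),
      Continuous[inferInstance, colimitTopology E M X U hU.subset] f →
      ∃ (k : ℕ) (g : K → HolMap E (U k) X),
        Continuous g ∧ f = HolMap.toGerm (hU.subset k) ∘ g) := by
  have : IsManifold 𝓘(ℂ, ℂ) 1 S := .of_le (n := ω) le_top
  have : IsManifold 𝓘(ℂ, E) 1 X := .of_le (n := ω) le_top
  have hMc := hM.isConnected.isPreconnected
  refine ⟨fun L hL => hU.exists_isCompact_image_toGerm_eq hMc hM.nontrivial hL,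
    fun K _ _ _ f hf => ?_⟩
  let _ := colimitTopology E M X U hU.subset
  have := hU.t2Space_colimitTopology (E := E) (X := X) hMc hM.nontrivial
  have hL : IsSeqCompact (Set.range f) :=
    image_univ (f := f) ▸ SeqCompactSpace.isSeqCompact_univ.image hf.seqContinuous
  obtain ⟨k, hk⟩ := hU.exists_isCompact_image_toGerm_eq hMc hM.nontrivial hL
  obtain ⟨C, hC, hCL⟩ := hk k le_rfl
  have hmem : ∀ x, ∃ g ∈ C, HolMap.toGerm (hU.subset k) g = f x := fun x => by
    have : f x ∈ HolMap.toGerm (hU.subset k) '' C := hCL ▸ mem_range_self x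
    exact this
  choose g hgC hg using hmem
  have : CompactSpace C := isCompact_iff_compactSpace.1 hC
  have hemb : IsClosedEmbedding (fun b : C => HolMap.toGerm (hU.subset k) b.1) :=
    ((HolMap.continuous_toGerm hU.subset k).comp continuous_subtype_val).isClosedEmbedding
      ((hU.toGerm_injective hMc hM.nontrivial k).comp Subtype.val_injective)
  have hgc : Continuous fun x => (⟨g x, hgC x⟩ : C) := by
    rw [hemb.isInducing.continuous_iff]
    exact hf.congr fun x => (hg x).symm
  exact ⟨k, g, continuous_subtype_val.comp hgc, funext fun x => (hg x).symm⟩
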